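/- Let $q\in\mathbb{C}\setminus\{0\}$ be not a root of unity. Let $A=\mathbb{C}_q[x^{\pm1},y^{\pm1}]$ be the unital $\mathbb{C}$-algebra with generators $x,x^{-1},y,y^{-1}$ and relations $yx=qxy$, $xx^{-1}=x^{-1}x=yy^{-1}=y^{-1}y=\mathbf 1$. Let $U_q(\mathfrak{sl}_2)$ be the Hopf algebra with generators $\mathsf k,\mathsf k^{-1},\mathsf e,\mathsf f$, relations $\mathsf k\mathsf k^{-1}=\mathsf k^{-1}\mathsf k=\mathbf 1$, $\mathsf{ke}=q^2\mathsf{ek}$, $\mathsf{kf}=q^{-2}\mathsf{fk}$, $\mathsf{ef}-\mathsf{fe}=\frac{\mathsf k-\mathsf k^{-1}}{q-q^{-1}}$, comultiplication $\Delta(\mathsf k)=\mathsf k\otimes\mathsf k$, $\Delta(\mathsf e)=\mathbf 1\otimes\mathsf e+\mathsf e\otimes\mathsf k$, $\Delta(\mathsf f)=\mathsf f\otimes\mathbf 1+\mathsf k^{-1}\otimes\mathsf f$, counit $\varepsilon(\mathsf k)=1$, $\varepsilon(\mathsf e)=\varepsilon(\mathsf f)=0$, and antipode $\mathsf S(\mathsf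 k)=\mathsf k^{-1}$, $\mathsf S(\mathsf e)=-\mathsf e\mathsf k^{-1}$, $\mathsf S(\mathsf f)=-\mathsf{kf}$. A $U_q(\mathfrak{sl}_2)$-symmetry on $A$ is a homomorphism of algebras $\pi\colon U_q(\mathfrak{sl}_2)\to\operatorname{End}_{\mathbb C}A$ such that $\pi(h)(ab)=\sum_{(h)}\pi(h_{(1)})(a)\,\pi(h_{(2)})(b)$ and $\pi(h)(\mathbf 1)=\varepsilon(h)\mathbf 1$ for all $h\in U_q(\mathfrak{sl}_2)$ and $a,b\in A$. Symmetries $\pi_1,\pi_2$ are isomorphic if there is an algebra automorphism $\Psi$ of $A$ with $\Psi\pi_1(h)\Psi^{-1}=\pi_2(h)$ for all $h$. A symmetry $\pi$ is called generic if there are $\alpha,\beta,a\in\mathbb C\setminus\{0\}$ and $u,v\in\mathbb Z$ such that $\alpha^u\beta^v=q^2$, $\alpha^m\beta^n\ne1$ for all integers $(m,n)\ne(0,0)$, and \begin{align*} \pi(\mathsf k)(x)&=\alpha x, & \pi(\mathsf k)(y)&=\beta y,\\ \pi(\mathsf e)(x)&=aq^{uv+3}\frac{1-\alpha q^v}{(1-q^2)^2}\,x^{u+1}y^v,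 & \pi(\mathsf e)(y)&=aq^{uv+3}\frac{q^u-\beta}{(1-q^2)^2}\,x^uy^{v+1},\\ \pi(\mathsf f)(x)&=-\frac{\alpha^{-1}-q^{-v}}{a}\,x^{-u+1}y^{-v}, & \pi(\mathsf f)(y)&=-\frac{\beta^{-1}q^{-u}-1}{a}\,x^{-u}y^{-v+1}. \end{align*} Then the collection of generic symmetries contains an uncountable family of isomorphism classes of $U_q(\mathfrak{sl}_2)$-symmetries on $A$: the set of isomorphism classes of $U_q(\mathfrak{sl}_2)$-symmetries on $A$ all of whose members are generic is uncountable. In particular, there is an uncountable family of pairwise non-isomorphic generic symmetries. -/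

import Mathlib

open scoped TensorProduct

noncomputable section

/-! ### The Laurent extension of the quantum plane -/

/-- The generators `x, x⁻¹, y, y⁻¹` of the algebra of quantum Laurent polynomials. -/
inductive LaurentGen : Type
  | x | xInv | y | yInv

/-- The defining relations `y x = q x y`, `x x⁻¹ = x⁻¹ x = 1`, `y y⁻¹ = y⁻¹ y = 1`. -/
inductive LaurentRel (q : ℂˣ) :
    FreeAlgebra ℂ LaurentGen → FreeAlgebra ℂ LaurentGen → Prop
  | yx : LaurentRel q
      (FreeAlgebra.ι ℂ LaurentGen.y * FreeAlgebra.ι ℂ LaurentGen.x)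
      ((q : ℂ) • (FreeAlgebra.ι ℂ LaurentGen.x * FreeAlgebra.ι ℂ LaurentGen.y))
  | x_xInv : LaurentRel q
      (FreeAlgebra.ι ℂ LaurentGen.x * FreeAlgebra.ι ℂ LaurentGen.xInv) 1
  | xInv_x : LaurentRel q
      (FreeAlgebra.ι ℂ LaurentGen.xInv * FreeAlgebra.ι ℂ LaurentGen.x) 1
  | y_yInv : LaurentRel q
      (FreeAlgebra.ι ℂ LaurentGen.y * FreeAlgebra.ι ℂ LaurentGen.yInv) 1
  | yInv_y : LaurentRel q
      (FreeAlgebra.ι ℂ LaurentGen.yInv * FreeAlgebra.ι ℂ LaurentGen.y) 1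

/-- The unital complex algebra `ℂ_q[x^{±1}, y^{±1}]`, by generators and relations. -/
def QLaurent (q : ℂˣ) : Type := RingQuot (LaurentRel q)

namespace QLaurent

instance (q : ℂˣ) : Ring (QLaurent q) := inferInstanceAs (Ring (RingQuot (LaurentRel q)))

instance (q : ℂˣ) : Algebra ℂ (QLaurent q) :=
  inferInstanceAs (Algebra ℂ (RingQuot (LaurentRel q)))

/-- The quotient map from the free algebra. -/
def mk (q : ℂˣ) : FreeAlgebra ℂ LaurentGen →ₐ[ℂ] QLaurent q :=
  RingQuot.mkAlgHom ℂ (LaurentRel q)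

/-- The generator `x`, as an invertible element. -/
def X (q : ℂˣ) : (QLaurent q)ˣ where
  val := mk q (FreeAlgebra.ι ℂ LaurentGen.x)
  inv := mk q (FreeAlgebra.ι ℂ LaurentGen.xInv)
  val_inv := by
    rw [← map_mul, ← map_one (mk q)]
    exact RingQuot.mkAlgHom_rel ℂ LaurentRel.x_xInv
  inv_val := by
    rw [← map_mul, ← map_one (mk q)]
    exact RingQuot.mkAlgHom_rel ℂ LaurentRel.xInv_x

/-- The generator `y`, as an invertible element. -/
def Y (q : ℂˣ) : (QLaurent q)ˣ where
  val := mk q (FreeAlgebra.ι ℂ LaurentGen.y)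
  inv := mk q (FreeAlgebra.ι ℂ LaurentGen.yInv)
  val_inv := by
    rw [← map_mul, ← map_one (mk q)]
    exact RingQuot.mkAlgHom_rel ℂ LaurentRel.y_yInv
  inv_val := by
    rw [← map_mul, ← map_one (mk q)]
    exact RingQuot.mkAlgHom_rel ℂ LaurentRel.yInv_y

/-- The monomial `x^i y^j`, for integers `i` and `j`. -/
def monomial (q : ℂˣ) (i j : ℤ) : QLaurent q := ((X q ^ i * Y q ^ j : (QLaurent q)ˣ) : QLaurent q)

end QLaurent

/-! ### The quantum universal enveloping algebra of `sl₂` -/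

/-- The Chevalley generators `k, k⁻¹, e, f`. -/
inductive UqGen : Type
  | k | kInv | e | f

/-- The defining relations of `U_q(sl₂)`. -/
inductive UqRel (q : ℂˣ) : FreeAlgebra ℂ UqGen → FreeAlgebra ℂ UqGen → Prop
  | kInv_k : UqRel q (FreeAlgebra.ι ℂ UqGen.kInv * FreeAlgebra.ι ℂ UqGen.k) 1
  | k_kInv : UqRel q (FreeAlgebra.ι ℂ UqGen.k * FreeAlgebra.ι ℂ UqGen.kInv) 1
  | ke : UqRel q
      (FreeAlgebra.ι ℂ UqGen.k * FreeAlgebra.ι ℂ UqGen.e)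
      (((q : ℂ) ^ 2) • (FreeAlgebra.ι ℂ UqGen.e * FreeAlgebra.ι ℂ UqGen.k))
  | kf : UqRel q
      (FreeAlgebra.ι ℂ UqGen.k * FreeAlgebra.ι ℂ UqGen.f)
      (((q : ℂ) ^ 2)⁻¹ • (FreeAlgebra.ι ℂ UqGen.f * FreeAlgebra.ι ℂ UqGen.k))
  | ef : UqRel q
      (FreeAlgebra.ι ℂ UqGen.e * FreeAlgebra.ι ℂ UqGen.f -
        FreeAlgebra.ι ℂ UqGen.f * FreeAlgebra.ι ℂ UqGen.e)
      (((q : ℂ) - (q : ℂ)⁻¹)⁻¹ • (FreeAlgebra.ι ℂ UqGen.k - FreeAlgebra.ι ℂ UqGen.kInv))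

/-- The unital complex algebra `U_q(sl₂)`, by generators and relations. -/
def Uq (q : ℂˣ) : Type := RingQuot (UqRel q)

namespace Uq

instance (q : ℂˣ) : Ring (Uq q) := inferInstanceAs (Ring (RingQuot (UqRel q)))

instance (q : ℂˣ) : Algebra ℂ (Uq q) := inferInstanceAs (Algebra ℂ (RingQuot (UqRel q)))

/-- The quotient map from the free algebra. -/
def mk (q : ℂˣ) : FreeAlgebra ℂ UqGen →ₐ[ℂ] Uq q := RingQuot.mkAlgHom ℂ (UqRel q)

/-- The generator `k`. -/
def k (q : ℂˣ) : Uq q := mk q (FreeAlgebra.ι ℂ UqGen.k)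

/-- The generator `k⁻¹`. -/
def kInv (q : ℂˣ) : Uq q := mk q (FreeAlgebra.ι ℂ UqGen.kInv)

/-- The generator `e`. -/
def e (q : ℂˣ) : Uq q := mk q (FreeAlgebra.ι ℂ UqGen.e)

/-- The generator `f`. -/
def f (q : ℂˣ) : Uq q := mk q (FreeAlgebra.ι ℂ UqGen.f)

variable (q : ℂˣ)

theorem mk_eq_mk {a b : FreeAlgebra ℂ UqGen} (h : UqRel q a b) : mk q a = mk q b :=
  RingQuot.mkAlgHom_rel ℂ h

theorem kInv_mul_k : kInv q * k q = 1 := by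
  have h := mk_eq_mk q UqRel.kInv_k
  simp only [map_mul, map_one] at h
  exact h

theorem k_mul_kInv : k q * kInv q = 1 := by
  have h := mk_eq_mk q UqRel.k_kInv
  simp only [map_mul, map_one] at h
  exact h

theorem k_mul_e : k q * e q = ((q : ℂ) ^ 2) • (e q * k q) := by
  have h := mk_eq_mk q UqRel.ke
  simp only [map_mul, map_smul] at h
  exact h

theorem k_mul_f : k q * f q = ((q : ℂ) ^ 2)⁻¹ • (f q * k q) := by
  have h := mk_eq_mk q UqRel.kf
  simp only [map_mul, map_smul] at h
  exact h

theorem e_mul_f_sub :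
    e q * f q - f q * e q = ((q : ℂ) - (q : ℂ)⁻¹)⁻¹ • (k q - kInv q) := by
  have h := mk_eq_mk q UqRel.ef
  simp only [map_mul, map_smul, map_sub] at h
  exact h

theorem e_mul_kInv : e q * kInv q = ((q : ℂ) ^ 2) • (kInv q * e q) := by
  calc e q * kInv q = kInv q * (k q * e q) * kInv q := by
        rw [← mul_assoc, kInv_mul_k, one_mul]
    _ = ((q : ℂ) ^ 2) • (kInv q * e q * (k q * kInv q)) := by
        rw [k_mul_e]; simp only [mul_smul_comm, smul_mul_assoc, mul_assoc]
    _ = _ := by rw [k_mul_kInv, mul_one]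

theorem f_mul_kInv : f q * kInv q = ((q : ℂ) ^ 2)⁻¹ • (kInv q * f q) := by
  calc f q * kInv q = kInv q * (k q * f q) * kInv q := by
        rw [← mul_assoc, kInv_mul_k, one_mul]
    _ = ((q : ℂ) ^ 2)⁻¹ • (kInv q * f q * (k q * kInv q)) := by
        rw [k_mul_f]; simp only [mul_smul_comm, smul_mul_assoc, mul_assoc]
    _ = _ := by rw [k_mul_kInv, mul_one]

variable {q}

/-- The homomorphism out of `U_q(sl₂)` determined by images of the generators that satisfy the
defining relations. -/
def lift {B : Type*} [Ring B] [Algebra ℂ B] (K K' E F : B)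
    (h₁ : K' * K = 1) (h₂ : K * K' = 1) (h₃ : K * E = ((q : ℂ) ^ 2) • (E * K))
    (h₄ : K * F = ((q : ℂ) ^ 2)⁻¹ • (F * K))
    (h₅ : E * F - F * E = ((q : ℂ) - (q : ℂ)⁻¹)⁻¹ • (K - K')) : Uq q →ₐ[ℂ] B :=
  RingQuot.liftAlgHom ℂ
    ⟨FreeAlgebra.lift ℂ (fun g => match g with
        | UqGen.k => K | UqGen.kInv => K' | UqGen.e => E | UqGen.f => F), by
      intro a b hab
      cases hab <;> simpa⟩

section lift

variable {B : Type*} [Ring B] [Algebra ℂ B] (K K' E F : B)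
    (h₁ : K' * K = 1) (h₂ : K * K' = 1) (h₃ : K * E = ((q : ℂ) ^ 2) • (E * K))
    (h₄ : K * F = ((q : ℂ) ^ 2)⁻¹ • (F * K))
    (h₅ : E * F - F * E = ((q : ℂ) - (q : ℂ)⁻¹)⁻¹ • (K - K'))

@[simp] theorem lift_k : lift (q := q) K K' E F h₁ h₂ h₃ h₄ h₅ (k q) = K := 
  (RingQuot.liftAlgHom_mkAlgHom_apply ℂ _ _ _).trans (by simp)

@[simp] theorem lift_kInv : lift (q := q) K K' E F h₁ h₂ h₃ h₄ h₅ (kInv q) = K' := 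
  (RingQuot.liftAlgHom_mkAlgHom_apply ℂ _ _ _).trans (by simp)

@[simp] theorem lift_e : lift (q := q) K K' E F h₁ h₂ h₃ h₄ h₅ (e q) = E := 
  (RingQuot.liftAlgHom_mkAlgHom_apply ℂ _ _ _).trans (by simp)

@[simp] theorem lift_f : lift (q := q) K K' E F h₁ h₂ h₃ h₄ h₅ (f q) = F := 
  (RingQuot.liftAlgHom_mkAlgHom_apply ℂ _ _ _).trans (by simp)

end lift

theorem algHom_ext {B : Type*} [Semiring B] [Algebra ℂ B] {φ ψ : Uq q →ₐ[ℂ] B}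
    (hk : φ (k q) = ψ (k q)) (hk' : φ (kInv q) = ψ (kInv q)) (he : φ (e q) = ψ (e q))
    (hf : φ (f q) = ψ (f q)) : φ = ψ := by
  refine RingQuot.ringQuot_ext' (S := ℂ) φ ψ ?_
  apply FreeAlgebra.hom_ext
  funext g
  cases g
  exacts [hk, hk', he, hf]

variable (q)

/-- The comultiplication: `Δ(k) = k ⊗ k`, `Δ(e) = 1 ⊗ e + e ⊗ k`, `Δ(f) = f ⊗ 1 + k⁻¹ ⊗ f`. -/
def comulHom : Uq q →ₐ[ℂ] Uq q ⊗[ℂ] Uq q :=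
  lift (k q ⊗ₜ k q) (kInv q ⊗ₜ kInv q) (1 ⊗ₜ e q + e q ⊗ₜ k q) (f q ⊗ₜ 1 + kInv q ⊗ₜ f q)
    (by simp [kInv_mul_k, Algebra.TensorProduct.one_def])
    (by simp [k_mul_kInv, Algebra.TensorProduct.one_def])
    (by
      simp only [mul_add, add_mul, Algebra.TensorProduct.tmul_mul_tmul, k_mul_e, mul_one, one_mul,
        smul_add, TensorProduct.tmul_smul, TensorProduct.smul_tmul'])
    (by
      have hkk : k q * kInv q = kInv q * k q := by rw [k_mul_kInv, kInv_mul_k]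
      simp only [mul_add, add_mul, Algebra.TensorProduct.tmul_mul_tmul, k_mul_f, mul_one, one_mul,
        smul_add, TensorProduct.tmul_smul, TensorProduct.smul_tmul', hkk])
    (by
      have hq : ((q : ℂ) ^ 2) * ((q : ℂ) ^ 2)⁻¹ = 1 := mul_inv_cancel₀ (by simp)
      have h : (e q * kInv q) ⊗ₜ[ℂ] (k q * f q) = (kInv q * e q) ⊗ₜ[ℂ] (f q * k q) := by
        rw [e_mul_kInv, k_mul_f, TensorProduct.tmul_smul, ← TensorProduct.smul_tmul', smul_smul,
          mul_comm, hq, one_smul]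
      have h1 : e q * f q = f q * e q + ((q : ℂ) - (q : ℂ)⁻¹)⁻¹ • (k q - kInv q) := by
        rw [← e_mul_f_sub]; abel
      simp only [mul_add, add_mul, Algebra.TensorProduct.tmul_mul_tmul, mul_one, one_mul, h, h1,
        TensorProduct.add_tmul, TensorProduct.tmul_add, TensorProduct.tmul_smul,
        ← TensorProduct.smul_tmul', TensorProduct.tmul_sub, TensorProduct.sub_tmul, smul_sub]
      abel)

/-- The counit: `ε(k) = 1`, `ε(e) = ε(f) = 0`. -/
def counitHom : Uq q →ₐ[ℂ] ℂ :=
  lift 1 1 0 0 (by simp) (by simp) (by simp) (by simp) (by simp)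

/-- The standard bialgebra structure on `U_q(sl₂)`. -/
instance : Bialgebra ℂ (Uq q) :=
  Bialgebra.ofAlgHom (comulHom q) (counitHom q)
    (by
      apply algHom_ext <;>
        simp [comulHom, TensorProduct.add_tmul, TensorProduct.tmul_add, add_assoc,
          Algebra.TensorProduct.one_def])
    (by apply algHom_ext <;> simp [comulHom, counitHom])
    (by apply algHom_ext <;> simp [comulHom, counitHom])

/-- The antipode `S(k) = k⁻¹`, `S(e) = -e k⁻¹`, `S(f) = -k f`, as a homomorphism to the opposite
algebra. -/
def antipodeHom : Uq q →ₐ[ℂ] (Uq q)ᵐᵒᵖ :=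
  lift (MulOpposite.op (kInv q)) (MulOpposite.op (k q)) (MulOpposite.op (-(e q * kInv q)))
    (MulOpposite.op (-(k q * f q)))
    (by rw [← MulOpposite.op_mul, kInv_mul_k, MulOpposite.op_one])
    (by rw [← MulOpposite.op_mul, k_mul_kInv, MulOpposite.op_one])
    (by
      rw [← MulOpposite.op_mul, ← MulOpposite.op_mul, ← MulOpposite.op_smul]
      congr 1
      rw [mul_neg, ← mul_assoc, neg_mul, smul_neg, ← smul_mul_assoc, ← e_mul_kInv])
    (by
      rw [← MulOpposite.op_mul, ← MulOpposite.op_mul, ← MulOpposite.op_smul]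
      congr 1
      rw [neg_mul, mul_neg, mul_assoc, f_mul_kInv, ← mul_assoc, kInv_mul_k, one_mul,
        mul_smul_comm, ← mul_assoc, k_mul_kInv, one_mul, smul_neg])
    (by
      have h1 : e q * kInv q * (k q * f q) = e q * f q := by
        rw [mul_assoc, ← mul_assoc (kInv q), kInv_mul_k, one_mul]
      have h2 : k q * f q * (e q * kInv q) = f q * e q := by
        have hq : ((q : ℂ) ^ 2)⁻¹ * ((q : ℂ) ^ 2) = 1 := inv_mul_cancel₀ (by simp)
        rw [e_mul_kInv, mul_smul_comm, k_mul_f, smul_mul_assoc, mul_assoc, ← mul_assoc (k q),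
          k_mul_kInv, one_mul, smul_smul, mul_comm, hq, one_smul]
      simp only [← MulOpposite.op_mul, ← MulOpposite.op_sub, ← MulOpposite.op_smul, neg_mul_neg,
        h1, h2]
      congr 1
      rw [← neg_sub, e_mul_f_sub, ← smul_neg, neg_sub])

/-- The antipode, as a linear map. -/
def antipodeLin : Uq q →ₗ[ℂ] Uq q :=
  (MulOpposite.opLinearEquiv ℂ).symm.toLinearMap ∘ₗ (antipodeHom q).toLinearMap

theorem antipodeLin_apply (a : Uq q) : antipodeLin q a = (antipodeHom q a).unop := rfl

theorem antipodeLin_mul (a b : Uq q) :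
    antipodeLin q (a * b) = antipodeLin q b * antipodeLin q a := by
  simp [antipodeLin_apply]

variable {q} in
theorem induction_on {P : Uq q → Prop} (a : Uq q) (hc : ∀ c : ℂ, P (algebraMap ℂ (Uq q) c))
    (hk : P (k q)) (hk' : P (kInv q)) (he : P (e q)) (hf : P (f q))
    (hmul : ∀ a b, P a → P b → P (a * b)) (hadd : ∀ a b, P a → P b → P (a + b)) : P a := by
  obtain ⟨a, rfl⟩ : ∃ b, mk q b = a := RingQuot.mkAlgHom_surjective ℂ (UqRel q) a
  induction a using FreeAlgebra.induction with
  | grade0 c => rw [AlgHom.commutes]; exact hc c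
  | grade1 g => cases g <;> assumption
  | mul a b ha hb => rw [map_mul]; exact hmul _ _ ha hb
  | add a b ha hb => rw [map_add]; exact hadd _ _ ha hb

theorem antipode_left (a : Uq q) :
    LinearMap.mul' ℂ (Uq q) ((antipodeLin q).rTensor (Uq q) (comulHom q a)) =
      algebraMap ℂ (Uq q) (counitHom q a) := by
  induction a using induction_on with
  | hc c => simp [Algebra.TensorProduct.algebraMap_apply, antipodeLin_apply]
  | hk => simp [comulHom, counitHom, antipodeLin_apply, antipodeHom, kInv_mul_k]
  | hk' => simp [comulHom, counitHom, antipodeLin_apply, antipodeHom, k_mul_kInv]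
  | he => simp [comulHom, counitHom, antipodeLin_apply, antipodeHom, mul_assoc, kInv_mul_k]
  | hf => simp [comulHom, counitHom, antipodeLin_apply, antipodeHom]
  | hadd a b ha hb => simp only [map_add, ha, hb]
  | hmul a b ha hb =>
    have h (t : Uq q ⊗[ℂ] Uq q) (u v : Uq q) :
        LinearMap.mul' ℂ (Uq q) ((antipodeLin q).rTensor (Uq q) (t * u ⊗ₜ v)) =
          antipodeLin q u * LinearMap.mul' ℂ (Uq q) ((antipodeLin q).rTensor (Uq q) t) * v := by
      induction t with
      | zero => simp
      | tmul x y => simp [antipodeLin_mul, mul_assoc]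
      | add x y hx hy => simp only [add_mul, mul_add, map_add, hx, hy]
    have h' (u : Uq q ⊗[ℂ] Uq q) :
        LinearMap.mul' ℂ (Uq q) ((antipodeLin q).rTensor (Uq q) (comulHom q a * u)) =
          algebraMap ℂ (Uq q) (counitHom q a) *
            LinearMap.mul' ℂ (Uq q) ((antipodeLin q).rTensor (Uq q) u) := by
      induction u with
      | zero => simp
      | tmul x y =>
        rw [h, ha, ← Algebra.commutes, mul_assoc]
        simp
      | add x y hx hy => simp only [mul_add, map_add, hx, hy]
    rw [map_mul, h', hb, map_mul, map_mul]

theorem antipode_right (a : Uq q) :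
    LinearMap.mul' ℂ (Uq q) ((antipodeLin q).lTensor (Uq q) (comulHom q a)) =
      algebraMap ℂ (Uq q) (counitHom q a) := by
  induction a using induction_on with
  | hc c => simp [Algebra.TensorProduct.algebraMap_apply, antipodeLin_apply]
  | hk => simp [comulHom, counitHom, antipodeLin_apply, antipodeHom, k_mul_kInv]
  | hk' => simp [comulHom, counitHom, antipodeLin_apply, antipodeHom, kInv_mul_k]
  | he => simp [comulHom, counitHom, antipodeLin_apply, antipodeHom]
  | hf => simp [comulHom, counitHom, antipodeLin_apply, antipodeHom, ← mul_assoc, kInv_mul_k]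
  | hadd a b ha hb => simp only [map_add, ha, hb]
  | hmul a b ha hb =>
    have h (t : Uq q ⊗[ℂ] Uq q) (u v : Uq q) :
        LinearMap.mul' ℂ (Uq q) ((antipodeLin q).lTensor (Uq q) (u ⊗ₜ v * t)) =
          u * LinearMap.mul' ℂ (Uq q) ((antipodeLin q).lTensor (Uq q) t) * antipodeLin q v := by
      induction t with
      | zero => simp
      | tmul x y => simp [antipodeLin_mul, mul_assoc]
      | add x y hx hy => simp only [add_mul, mul_add, map_add, hx, hy]
    have h' (u : Uq q ⊗[ℂ] Uq q) :
        LinearMap.mul' ℂ (Uq q) ((antipodeLin q).lTensor (Uq q) (u * comulHom q b)) =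
          LinearMap.mul' ℂ (Uq q) ((antipodeLin q).lTensor (Uq q) u) *
            algebraMap ℂ (Uq q) (counitHom q b) := by
      induction u with
      | zero => simp
      | tmul x y =>
        rw [h, hb, mul_assoc, Algebra.commutes, ← mul_assoc]
        simp
      | add x y hx hy => simp only [add_mul, map_add, hx, hy]
    rw [map_mul, h', ha, map_mul, map_mul]

/-- The standard Hopf algebra structure on `U_q(sl₂)`. -/
instance : HopfAlgebra ℂ (Uq q) where
  antipode := antipodeLin q
  mul_antipode_rTensor_comul := LinearMap.ext (antipode_left q)
  mul_antipode_lTensor_comul := LinearMap.ext (antipode_right q)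

end Uq

/-! ### Symmetries -/

/-- A structure of `H`-module algebra on `A` (an `H`-symmetry): an algebra homomorphism
`π : H → End_ℂ(A)` with `π(h)(ab) = ∑ π(h₁)(a) π(h₂)(b)` and `π(h)(1) = ε(h) 1`. -/
structure HSymmetry (H A : Type*) [Ring H] [HopfAlgebra ℂ H] [Ring A] [Algebra ℂ A] where
  /-- The underlying representation. -/
  toAlgHom : H →ₐ[ℂ] Module.End ℂ A
  /-- The sum `∑ π(h₁)(a) π(h₂)(b)` is the image of `Δ(h)` under the linear map
  `H ⊗ H → A` sending `h₁ ⊗ h₂` to `π(h₁)(a) π(h₂)(b)`. -/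
  apply_mul : ∀ (h : H) (a b : A),
    toAlgHom h (a * b) =
      LinearMap.mul' ℂ A
        (TensorProduct.map (toAlgHom.toLinearMap.flip a) (toAlgHom.toLinearMap.flip b)
          (Coalgebra.comul (R := ℂ) h))
  apply_one : ∀ h : H, toAlgHom h 1 = Coalgebra.counit (R := ℂ) h • (1 : A)

namespace HSymmetry

variable {H A : Type*} [Ring H] [HopfAlgebra ℂ H] [Ring A] [Algebra ℂ A]

/-- Two symmetries are isomorphic if some algebra automorphism `Ψ` of `A` satisfies
`Ψ π₁(h) Ψ⁻¹ = π₂(h)` for all `h`. -/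
def IsIsomorphic (π₁ π₂ : HSymmetry H A) : Prop :=
  ∃ Ψ : A ≃ₐ[ℂ] A, ∀ (h : H) (a : A), Ψ (π₁.toAlgHom h (Ψ.symm a)) = π₂.toAlgHom h a

/-- Isomorphism of symmetries as an equivalence relation. -/
def isoSetoid (H A : Type*) [Ring H] [HopfAlgebra ℂ H] [Ring A] [Algebra ℂ A] :
    Setoid (HSymmetry H A) where
  r := IsIsomorphic
  iseqv :=
    { refl := fun _ => ⟨AlgEquiv.refl, fun _ _ => rfl⟩
      symm := by
        rintro _ _ ⟨Ψ, hΨ⟩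
        refine ⟨Ψ.symm, fun h a => ?_⟩
        rw [← hΨ]
        simp
      trans := by
        rintro _ _ _ ⟨Ψ, hΨ⟩ ⟨Φ, hΦ⟩
        refine ⟨Ψ.trans Φ, fun h a => ?_⟩
        rw [← hΦ, ← hΨ]
        simp }

end HSymmetry

/-- The `U_q(sl₂)`-symmetries on `ℂ_q[x^{±1}, y^{±1}]`. -/
abbrev UqSymmetry (q : ℂˣ) : Type := HSymmetry (Uq q) (QLaurent q)

/-- The generic symmetries: those given by the explicit formulas below, for weight constants
`α, β` that satisfy `α^u β^v = q²` for some integers `u, v` and admit no relation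
`α^m β^n = 1` with `(m, n) ≠ (0, 0)`, and for a nonzero parameter `a`. -/
def genericSymmetries (q : ℂˣ) : Set (UqSymmetry q) :=
  {π | ∃ (α β a : ℂ) (u v : ℤ), α ≠ 0 ∧ β ≠ 0 ∧ a ≠ 0 ∧
    α ^ u * β ^ v = (q : ℂ) ^ 2 ∧
    (∀ m n : ℤ, (m, n) ≠ (0, 0) → α ^ m * β ^ n ≠ 1) ∧
    π.toAlgHom (Uq.k q) (QLaurent.X q) = α • (QLaurent.X q : QLaurent q) ∧
    π.toAlgHom (Uq.k q) (QLaurent.Y q) = β • (QLaurent.Y q : QLaurent q) ∧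
    π.toAlgHom (Uq.e q) (QLaurent.X q) =
      (a * (q : ℂ) ^ (u * v + 3) * ((1 - α * (q : ℂ) ^ v) / (1 - (q : ℂ) ^ 2) ^ 2)) •
        QLaurent.monomial q (u + 1) v ∧
    π.toAlgHom (Uq.e q) (QLaurent.Y q) =
      (a * (q : ℂ) ^ (u * v + 3) * (((q : ℂ) ^ u - β) / (1 - (q : ℂ) ^ 2) ^ 2)) •
        QLaurent.monomial q u (v + 1) ∧
    π.toAlgHom (Uq.f q) (QLaurent.X q) =
      (-((α⁻¹ - (q : ℂ) ^ (-v)) / a)) • QLaurent.monomial q (-u + 1) (-v) ∧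
    π.toAlgHom (Uq.f q) (QLaurent.Y q) =
      (-((β⁻¹ * (q : ℂ) ^ (-u) - 1) / a)) • QLaurent.monomial q (-u) (-v + 1)}

end

/-!
A symmetry is of inner type (`HSymmetry.IsInner`) if `e` acts as `a ↦ a M - M k(a)` and `f` as
`a ↦ N a - k⁻¹(a) N`, where `M` is a unit of weight `q²`, `M N` is the scalar `q³ / (1 - q²)²`, and
`k` acts diagonally on the units and fixes only the scalar ones. These conditions do not mention
the generators `x` and `y`, so they are invariant under isomorphism (`IsInner.of_isIsomorphic`).

The units of the quantum torus are exactly the nonzero multiples of monomials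
(`QLaurent.exists_eq_smul_monomial`): the monomials are linearly independent, as the action on
functions on `ℤ²` shows, and the group `ℤ²` has the two-unique-sums property. Hence `M` is a
multiple of some `x^u y^v` and `N` of `x^{-u} y^{-v}`, and evaluation at `x` and `y` gives the
generic formulas (`mem_genericSymmetries_of_isInner`). So the isomorphism class of a symmetry of
inner type consists of generic symmetries.

Every automorphism `K`, together with such `M` and `N`, does give a symmetry (`HSymmetry.inner`).
With `M = x`, with `q²` as the weight of `x`, and with any independent weight `β` of `y`, it is of
inner type (`exists_isInner`). All but countably many `β` are independent of `q²`. In the class of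
the symmetry with weight `β`, every weight of `y` is the weight of a unit, hence lies in the
countable group generated by `q²` and `β`. Thus each class meets the uncountable family in a
countable set, and there are uncountably many classes.
-/

open scoped TensorProduct

noncomputable section

/-! ### Homomorphisms out of the quantum torus -/

namespace QLaurent

variable {q : ℂˣ}

theorem Y_mul_X : (Y q : QLaurent q) * X q = (q : ℂ) • ((X q : QLaurent q) * Y q) := by
  change mk q _ * mk q _ = _ • (mk q _ * mk q _)
  rw [← map_mul, ← map_mul, ← map_smul]
  exact RingQuot.mkAlgHom_rel ℂ LaurentRel.yx

/-- The homomorphism out of `ℂ_q[x^{±1}, y^{±1}]` determined by two units that satisfy the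
defining relation of the quantum plane. -/
def lift {B : Type*} [Semiring B] [Algebra ℂ B] (U V : Bˣ)
    (h : (V : B) * U = (q : ℂ) • ((U : B) * V)) : QLaurent q →ₐ[ℂ] B :=
  RingQuot.liftAlgHom ℂ
    ⟨FreeAlgebra.lift ℂ (fun g => match g with
        | LaurentGen.x => (U : B) | LaurentGen.xInv => ((U⁻¹ : Bˣ) : B)
        | LaurentGen.y => (V : B) | LaurentGen.yInv => ((V⁻¹ : Bˣ) : B)), by
      intro a b hab
      cases hab <;> simp [h]⟩

section lift

variable {B : Type*} [Semiring B] [Algebra ℂ B] (U V : Bˣ)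
    (h : (V : B) * U = (q : ℂ) • ((U : B) * V))

@[simp] theorem lift_X : lift U V h (X q) = U :=
  (RingQuot.liftAlgHom_mkAlgHom_apply ℂ _ _ _).trans (by simp)

@[simp] theorem lift_Y : lift U V h (Y q) = V :=
  (RingQuot.liftAlgHom_mkAlgHom_apply ℂ _ _ _).trans (by simp)

end lift

theorem induction_on {P : QLaurent q → Prop} (a : QLaurent q)
    (hc : ∀ c : ℂ, P (algebraMap ℂ (QLaurent q) c))
    (hX : P (X q)) (hX' : P ((X q)⁻¹ : (QLaurent q)ˣ)) (hY : P (Y q))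
    (hY' : P ((Y q)⁻¹ : (QLaurent q)ˣ))
    (hmul : ∀ a b, P a → P b → P (a * b)) (hadd : ∀ a b, P a → P b → P (a + b)) : P a := by
  obtain ⟨a, rfl⟩ : ∃ b, mk q b = a := RingQuot.mkAlgHom_surjective ℂ (LaurentRel q) a
  induction a using FreeAlgebra.induction with
  | grade0 c => rw [AlgHom.commutes]; exact hc c
  | grade1 g => cases g <;> assumption
  | mul a b ha hb => rw [map_mul]; exact hmul _ _ ha hb
  | add a b ha hb => rw [map_add]; exact hadd _ _ ha hb

theorem algHom_ext {B : Type*} [Semiring B] [Algebra ℂ B] {φ ψ : QLaurent q →ₐ[ℂ] B}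
    (hX : φ (X q) = ψ (X q)) (hY : φ (Y q) = ψ (Y q)) : φ = ψ := by
  have hinv (w : (QLaurent q)ˣ) (hw : φ w = ψ w) :
      φ ((w⁻¹ : (QLaurent q)ˣ) : QLaurent q) = ψ ((w⁻¹ : (QLaurent q)ˣ) : QLaurent q) := by
    have h : Units.map (φ : QLaurent q →* B) w = Units.map (ψ : QLaurent q →* B) w :=
      Units.ext hw
    have h' := congrArg (fun v : Bˣ => ((v⁻¹ : Bˣ) : B)) h
    exact h'
  refine AlgHom.ext fun a => ?_
  induction a using induction_on with
  | hc c => simp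
  | hX => exact hX
  | hX' => exact hinv _ hX
  | hY => exact hY
  | hY' => exact hinv _ hY
  | hmul a b ha hb => rw [map_mul, map_mul, ha, hb]
  | hadd a b ha hb => rw [map_add, map_add, ha, hb]

/-! ### The monomial basis -/

/-- A nonzero scalar, as a unit of an algebra. -/
def unitScalar (B : Type*) [Ring B] [Algebra ℂ B] : ℂˣ →* Bˣ :=
  Units.map (algebraMap ℂ B : ℂ →* B)

theorem coe_unitScalar {B : Type*} [Ring B] [Algebra ℂ B] (c : ℂˣ) :
    (unitScalar B c : B) = algebraMap ℂ B c := rfl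

theorem commute_unitScalar {B : Type*} [Ring B] [Algebra ℂ B] (c : ℂˣ) (w : Bˣ) :
    Commute (unitScalar B c) w :=
  Units.ext (Algebra.commutes _ _)

/-- The commutation rule for powers of `q`-commuting units. -/
theorem zpow_mul_zpow_comm {B : Type*} [Ring B] [Algebra ℂ B] (U V : Bˣ)
    (h : V * U = unitScalar B q * (U * V)) (i j : ℤ) :
    V ^ j * U ^ i = unitScalar B (q ^ (i * j)) * (U ^ i * V ^ j) := by
  have h1 : V * U ^ i * V⁻¹ = unitScalar B (q ^ i) * U ^ i := by
    rw [← conj_zpow, h, ← mul_assoc, mul_inv_cancel_right, (commute_unitScalar q U).mul_zpow,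
      map_zpow]
  have h2 : U ^ (-i) * V * (U ^ (-i))⁻¹ = unitScalar B (q ^ i) * V := by
    rw [zpow_neg, inv_inv, mul_assoc, eq_mul_inv_iff_mul_eq.1 h1.symm |>.symm, mul_assoc,
      ← mul_assoc, ((commute_unitScalar (q ^ i) (U ^ i)⁻¹)).symm.eq]
    simp [mul_assoc]
  have h3 : U ^ (-i) * V ^ j * (U ^ (-i))⁻¹ = unitScalar B (q ^ (i * j)) * V ^ j := by
    rw [← conj_zpow, h2, (commute_unitScalar _ V).mul_zpow, ← map_zpow, zpow_mul]
  have h4 : V ^ j * U ^ i = U ^ i * (unitScalar B (q ^ (i * j)) * V ^ j) := by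
    rw [← h3]; simp [mul_assoc]
  rw [h4, ← mul_assoc, ← mul_assoc, (commute_unitScalar _ (U ^ i)).eq]

theorem Y_zpow_mul_X_zpow (i j : ℤ) :
    Y q ^ j * X q ^ i = unitScalar _ (q ^ (i * j)) * (X q ^ i * Y q ^ j) := by
  refine zpow_mul_zpow_comm _ _ (Units.ext ?_) i j
  simp [Y_mul_X, coe_unitScalar, Algebra.smul_def]

theorem monomial_mul_monomial (i j k l : ℤ) :
    monomial q i j * monomial q k l =
      ((q : ℂ) ^ (j * k)) • monomial q (i + k) (j + l) := by
  have h : X q ^ i * Y q ^ j * (X q ^ k * Y q ^ l) =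
      unitScalar _ (q ^ (j * k)) * (X q ^ (i + k) * Y q ^ (j + l)) := by
    rw [mul_assoc, ← mul_assoc (Y q ^ j), Y_zpow_mul_X_zpow, mul_comm k j, zpow_add, zpow_add]
    simp only [mul_assoc]
    rw [← mul_assoc, ← (commute_unitScalar _ (X q ^ i)).eq, mul_assoc]
  have h' := congrArg Units.val h
  rw [Units.val_mul, Units.val_mul (unitScalar _ _), coe_unitScalar, ← Algebra.smul_def,
    Units.val_zpow_eq_zpow_val] at h'
  exact h'

theorem monomial_zero : monomial q 0 0 = 1 := by simp [monomial]

theorem X_eq_monomial : (X q : QLaurent q) = monomial q 1 0 := by simp [monomial]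

theorem Y_eq_monomial : (Y q : QLaurent q) = monomial q 0 1 := by simp [monomial]

theorem span_monomial :
    Submodule.span ℂ (Set.range fun p : ℤ × ℤ => monomial q p.1 p.2) = ⊤ := by
  set S := Submodule.span ℂ (Set.range fun p : ℤ × ℤ => monomial q p.1 p.2) with hS
  have hm (i j : ℤ) : monomial q i j ∈ S := Submodule.subset_span ⟨(i, j), rfl⟩
  have hSS : S * S ≤ S := by
    rw [hS, Submodule.span_mul_span, Submodule.span_le]
    rintro _ ⟨_, ⟨p, rfl⟩, _, ⟨r, rfl⟩, rfl⟩
    simp only [monomial_mul_monomial]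
    exact S.smul_mem _ (hm _ _)
  refine eq_top_iff.2 fun a _ => ?_
  induction a using induction_on with
  | hc c =>
    rw [Algebra.algebraMap_eq_smul_one, ← monomial_zero]
    exact S.smul_mem _ (hm _ _)
  | hX => rw [X_eq_monomial]; exact hm _ _
  | hX' => simpa [monomial] using hm (-1) 0
  | hY => rw [Y_eq_monomial]; exact hm _ _
  | hY' => simpa [monomial] using hm 0 (-1)
  | hmul a b ha hb => exact hSS (Submodule.mul_mem_mul (ha trivial) (hb trivial))
  | hadd a b ha hb => exact S.add_mem (ha trivial) (hb trivial)

/-- The operator `δ_p ↦ q^(t p₁ + r) δ_(p+s)` on finitely supported functions on `ℤ²`. These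
operators are closed under multiplication, which makes powers and inverses explicit. -/
def weightedShift (q : ℂˣ) (s : ℤ × ℤ) (t r : ℤ) : Module.End ℂ (ℤ × ℤ →₀ ℂ) :=
  Finsupp.linearCombination ℂ fun p => Finsupp.single (p + s) ((q : ℂ) ^ (t * p.1 + r))

theorem weightedShift_single (s : ℤ × ℤ) (t r : ℤ) (p : ℤ × ℤ) :
    weightedShift q s t r (Finsupp.single p 1) =
      Finsupp.single (p + s) ((q : ℂ) ^ (t * p.1 + r)) := by
  simp [weightedShift]

theorem weightedShift_mul (s s' : ℤ × ℤ) (t t' r r' : ℤ) :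
    weightedShift q s t r * weightedShift q s' t' r' =
      weightedShift q (s' + s) (t + t') (t * s'.1 + r + r') := by
  ext p : 2
  have h (p : ℤ × ℤ) (c : ℂ) : (Finsupp.single p c : ℤ × ℤ →₀ ℂ) = c • Finsupp.single p 1 := by
    simp
  simp only [LinearMap.comp_apply, Finsupp.lsingle_apply, Module.End.mul_apply,
    weightedShift_single]
  rw [h (p + s'), map_smul, weightedShift_single, Finsupp.smul_single, smul_eq_mul,
    ← zpow_add₀ q.ne_zero, add_assoc p, Prod.fst_add]
  congr 2
  ring

theorem weightedShift_zero : weightedShift q 0 0 0 = 1 := by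
  ext p : 2
  simp [weightedShift]

/-- The operator `δ_(m,n) ↦ δ_(m+1,n)`, by which `x` acts. -/
def shiftX (q : ℂˣ) : (Module.End ℂ (ℤ × ℤ →₀ ℂ))ˣ where
  val := weightedShift q (1, 0) 0 0
  inv := weightedShift q (-1, 0) 0 0
  val_inv := by rw [weightedShift_mul, ← weightedShift_zero]; congr
  inv_val := by rw [weightedShift_mul, ← weightedShift_zero]; congr

/-- The operator `δ_(m,n) ↦ q^m δ_(m,n+1)`, by which `y` acts. -/
def shiftY (q : ℂˣ) : (Module.End ℂ (ℤ × ℤ →₀ ℂ))ˣ where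
  val := weightedShift q (0, 1) 1 0
  inv := weightedShift q (0, -1) (-1) 0
  val_inv := by rw [weightedShift_mul, ← weightedShift_zero]; congr
  inv_val := by rw [weightedShift_mul, ← weightedShift_zero]; congr

theorem shiftY_mul_shiftX (q : ℂˣ) :
    (shiftY q : Module.End ℂ (ℤ × ℤ →₀ ℂ)) * (shiftX q : Module.End ℂ (ℤ × ℤ →₀ ℂ)) =
      (q : ℂ) • ((shiftX q : Module.End ℂ (ℤ × ℤ →₀ ℂ)) * shiftY q) := by
  change weightedShift q (0, 1) 1 0 * weightedShift q (1, 0) 0 0 =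
    (q : ℂ) • (weightedShift q (1, 0) 0 0 * weightedShift q (0, 1) 1 0)
  rw [weightedShift_mul, weightedShift_mul]
  ext p : 2
  simp only [LinearMap.comp_apply, Finsupp.lsingle_apply, weightedShift_single,
    LinearMap.smul_apply, Finsupp.smul_single, smul_eq_mul]
  rw [← zpow_one_add₀ q.ne_zero]
  congr 2; ring

/-- The action of the quantum torus on finitely supported functions on `ℤ²`. -/
def latticeRep (q : ℂˣ) : QLaurent q →ₐ[ℂ] Module.End ℂ (ℤ × ℤ →₀ ℂ) :=
  lift (B := Module.End ℂ (ℤ × ℤ →₀ ℂ)) (shiftX q) (shiftY q) (shiftY_mul_shiftX q)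

theorem latticeRep_X : latticeRep q (X q) = (shiftX q : Module.End ℂ (ℤ × ℤ →₀ ℂ)) :=
  lift_X (B := Module.End ℂ (ℤ × ℤ →₀ ℂ)) (shiftX q) (shiftY q) (shiftY_mul_shiftX q)

theorem latticeRep_Y : latticeRep q (Y q) = (shiftY q : Module.End ℂ (ℤ × ℤ →₀ ℂ)) :=
  lift_Y (B := Module.End ℂ (ℤ × ℤ →₀ ℂ)) (shiftX q) (shiftY q) (shiftY_mul_shiftX q)

/-- The coefficients of an element in the monomials `x^i y^j`: the action on `δ₀`. -/
def coeffs (q : ℂˣ) : QLaurent q →ₗ[ℂ] (ℤ × ℤ →₀ ℂ) :=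
  (LinearMap.applyₗ (Finsupp.single 0 1)) ∘ₗ (latticeRep q).toLinearMap

theorem shiftX_zpow (i : ℤ) :
    ((shiftX q ^ i : (Module.End ℂ (ℤ × ℤ →₀ ℂ))ˣ) : Module.End ℂ (ℤ × ℤ →₀ ℂ)) =
      weightedShift q (i, 0) 0 0 := by
  induction i with
  | zero => exact weightedShift_zero.symm
  | succ i ih =>
    rw [zpow_add_one, Units.val_mul, ih]
    change _ * weightedShift q _ _ _ = _
    rw [weightedShift_mul]; congr 1; ext <;> simp [add_comm]
  | pred i ih =>
    rw [zpow_sub_one, Units.val_mul, ih]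
    change _ * weightedShift q _ _ _ = _
    rw [weightedShift_mul]; congr 1; ext <;> simp [sub_eq_add_neg, add_comm]

theorem shiftY_zpow (i : ℤ) :
    ((shiftY q ^ i : (Module.End ℂ (ℤ × ℤ →₀ ℂ))ˣ) : Module.End ℂ (ℤ × ℤ →₀ ℂ)) =
      weightedShift q (0, i) i 0 := by
  induction i with
  | zero => exact weightedShift_zero.symm
  | succ i ih =>
    rw [zpow_add_one, Units.val_mul, ih]
    change _ * weightedShift q _ _ _ = _
    rw [weightedShift_mul]; congr 1; simp [add_comm]
  | pred i ih =>
    rw [zpow_sub_one, Units.val_mul, ih]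
    change _ * weightedShift q _ _ _ = _
    rw [weightedShift_mul]; congr 1 <;> simp [sub_eq_add_neg, add_comm]

theorem coeffs_monomial (i j : ℤ) : coeffs q (monomial q i j) = Finsupp.single (i, j) 1 := by
  have hX : Units.map (latticeRep q : QLaurent q →* _) (X q) = shiftX q :=
    Units.ext latticeRep_X
  have hY : Units.map (latticeRep q : QLaurent q →* _) (Y q) = shiftY q :=
    Units.ext latticeRep_Y
  have h : latticeRep q (monomial q i j) =
      ((shiftX q ^ i * shiftY q ^ j : (Module.End ℂ (ℤ × ℤ →₀ ℂ))ˣ) : Module.End ℂ _) := by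
    rw [← hX, ← hY, ← map_zpow, ← map_zpow, ← map_mul]
    rfl
  change latticeRep q (monomial q i j) (Finsupp.single 0 1) = _
  rw [h, Units.val_mul, shiftX_zpow, shiftY_zpow, weightedShift_mul, weightedShift_single]
  simp

theorem linearCombination_coeffs (a : QLaurent q) :
    Finsupp.linearCombination ℂ (fun p : ℤ × ℤ => monomial q p.1 p.2) (coeffs q a) = a := by
  have h : a ∈ Submodule.span ℂ (Set.range fun p : ℤ × ℤ => monomial q p.1 p.2) := by
    rw [span_monomial]; trivial
  induction h using Submodule.span_induction with
  | mem _ h => obtain ⟨p, rfl⟩ := h; simp [coeffs_monomial]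
  | zero => simp
  | add a b _ _ ha hb => rw [map_add, map_add, ha, hb]
  | smul c a _ ha => rw [map_smul, map_smul, ha]

theorem coeffs_mul (a b : QLaurent q) :
    coeffs q (a * b) = ∑ p ∈ (coeffs q a).support, ∑ r ∈ (coeffs q b).support,
      Finsupp.single (p + r) (coeffs q a p * coeffs q b r * (q : ℂ) ^ (p.2 * r.1)) := by
  conv_lhs => rw [← linearCombination_coeffs a, ← linearCombination_coeffs b]
  simp only [Finsupp.linearCombination_apply, Finsupp.sum, Finset.sum_mul, Finset.mul_sum,
    map_sum, smul_mul_assoc, mul_smul_comm, map_smul, monomial_mul_monomial, coeffs_monomial]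
  simp only [Finset.smul_sum]
  rw [Finset.sum_comm]
  refine Finset.sum_congr rfl fun p _ => Finset.sum_congr rfl fun r _ => ?_
  simp only [Finsupp.smul_single, smul_eq_mul, mul_one]
  congr 1
  ring

/-- A pair of exponents whose sum is attained only once contributes a nonzero coefficient. -/
theorem coeffs_mul_ne_zero {a b : QLaurent q} {p r : ℤ × ℤ} (hp : p ∈ (coeffs q a).support)
    (hr : r ∈ (coeffs q b).support)
    (h : UniqueAdd (coeffs q a).support (coeffs q b).support p r) :
    coeffs q (a * b) (p + r) ≠ 0 := by
  have key : coeffs q (a * b) (p + r) =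
      coeffs q a p * coeffs q b r * (q : ℂ) ^ (p.2 * r.1) := by
    rw [coeffs_mul, Finsupp.finsetSum_apply, Finset.sum_eq_single_of_mem p hp,
      Finsupp.finsetSum_apply, Finset.sum_eq_single_of_mem r hr, Finsupp.single_eq_same]
    · intro r' hr' hne
      exact Finsupp.single_eq_of_ne fun he => hne (h hp hr' he.symm).2
    · intro p' hp' hne
      rw [Finsupp.finsetSum_apply]
      refine Finset.sum_eq_zero fun r' hr' => ?_
      exact Finsupp.single_eq_of_ne fun he => hne (h hp' hr' he.symm).1
  rw [key]
  exact mul_ne_zero (mul_ne_zero (Finsupp.mem_support_iff.1 hp) (Finsupp.mem_support_iff.1 hr))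
    (zpow_ne_zero _ q.ne_zero)

instance : Nontrivial (QLaurent q) :=
  ⟨1, 0, fun h => by
    have h' := congrArg (coeffs q) h
    rw [← monomial_zero, coeffs_monomial, map_zero] at h'
    simp at h'⟩

/-- Every unit is a scalar multiple of a monomial: were the support of the unit or of its inverse
larger than a point, two different products of monomials would survive in their product `1`. -/
theorem exists_eq_smul_monomial (w : (QLaurent q)ˣ) :
    ∃ (c : ℂˣ) (i j : ℤ), (w : QLaurent q) = (c : ℂ) • monomial q i j := by
  set a : QLaurent q := (↑w : QLaurent q)
  set b : QLaurent q := ((w⁻¹ : (QLaurent q)ˣ) : QLaurent q)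
  have hab : coeffs q (a * b) = Finsupp.single 0 1 := by
    rw [Units.mul_inv, ← monomial_zero, coeffs_monomial]; rfl
  have hne {p r : ℤ × ℤ} (hp : p ∈ (coeffs q a).support) (hr : r ∈ (coeffs q b).support)
      (h : UniqueAdd (coeffs q a).support (coeffs q b).support p r) : 0 = p + r := by
    by_contra hpr
    exact coeffs_mul_ne_zero hp hr h (by rw [hab, Finsupp.single_eq_of_ne (Ne.symm hpr)])
  -- Two distinct pairs with unique sums would both sum to `0`, against uniqueness.
  have hcard : (coeffs q a).support.card * (coeffs q b).support.card ≤ 1 := by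
    by_contra! hlt
    obtain ⟨p, hp, r, hr, hpr, hup, hur⟩ := TwoUniqueSums.uniqueAdd_of_one_lt_card hlt
    rw [Finset.mem_product] at hp hr
    have he := (hne hr.1 hr.2 hur).symm.trans (hne hp.1 hp.2 hup)
    have hh := hup hr.1 hr.2 he
    exact hpr (Prod.ext hh.1.symm hh.2.symm)
  have h0 : ∀ d : QLaurent q, d ≠ 0 → 0 < (coeffs q d).support.card := by
    intro d hd
    rw [Finset.card_pos, Finsupp.support_nonempty_iff]
    intro h
    apply hd
    rw [← linearCombination_coeffs d, h, map_zero]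
  have ha := h0 a w.ne_zero
  have hb := h0 b (w⁻¹).ne_zero
  have h1 : (coeffs q a).support.card = 1 := by nlinarith
  obtain ⟨p, c, hc, hpc⟩ := Finsupp.card_support_eq_one'.1 h1
  refine ⟨Units.mk0 c hc, p.1, p.2, ?_⟩
  rw [Units.val_mk0, ← linearCombination_coeffs a, hpc]
  simp

theorem eq_of_monomial_eq_smul {i j k l : ℤ} {c : ℂ}
    (h : monomial q i j = c • monomial q k l) : (i, j) = (k, l) ∧ c = 1 := by
  have h' := congrArg (coeffs q) h
  rw [map_smul, coeffs_monomial, coeffs_monomial, Finsupp.smul_single, smul_eq_mul, mul_one,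
    Finsupp.single_eq_single_iff] at h'
  simpa [eq_comm (a := c)] using h'

end QLaurent

/-! ### Symmetries from generators -/

namespace HSymmetry

variable {q : ℂˣ} {A : Type*} [Ring A] [Algebra ℂ A]

/-- The action of `U_q(sl₂) ⊗ U_q(sl₂)` on `A ⊗ A` given by a representation on `A`. -/
def tensorRep (φ : Uq q →ₐ[ℂ] Module.End ℂ A) :
    Uq q ⊗[ℂ] Uq q →ₐ[ℂ] Module.End ℂ (A ⊗[ℂ] A) :=
  (Module.endTensorEndAlgHom (R := ℂ) (S := ℂ) (A := ℂ) (M := A) (N := A)).comp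
    (Algebra.TensorProduct.map φ φ)

theorem tensorRep_tmul (φ : Uq q →ₐ[ℂ] Module.End ℂ A) (g h : Uq q) (a b : A) :
    tensorRep φ (g ⊗ₜ h) (a ⊗ₜ b) = φ g a ⊗ₜ φ h b := by
  simp [tensorRep, Module.endTensorEndAlgHom_apply]

theorem tensorRep_apply_tmul (φ : Uq q →ₐ[ℂ] Module.End ℂ A) (t : Uq q ⊗[ℂ] Uq q) (a b : A) :
    tensorRep φ t (a ⊗ₜ b) =
      TensorProduct.map (φ.toLinearMap.flip a) (φ.toLinearMap.flip b) t := by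
  induction t with
  | zero => simp
  | tmul g h => rw [tensorRep_tmul]; rfl
  | add s t hs ht => rw [map_add, map_add, LinearMap.add_apply, hs, ht]

theorem comul_eq (h : Uq q) : Coalgebra.comul (R := ℂ) h = Uq.comulHom q h := rfl

theorem counit_eq (h : Uq q) : Coalgebra.counit (R := ℂ) h = Uq.counitHom q h := rfl

theorem apply_mul_eq_tensorRep (π : HSymmetry (Uq q) A) (h : Uq q) (a b : A) :
    π.toAlgHom h (a * b) =
      LinearMap.mul' ℂ A (tensorRep π.toAlgHom (Uq.comulHom q h) (a ⊗ₜ b)) := by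
  rw [π.apply_mul, tensorRep_apply_tmul, comul_eq]

/-- A representation whose generators obey the (skew) Leibniz rules is a symmetry. -/
def ofGenerators (φ : Uq q →ₐ[ℂ] Module.End ℂ A)
    (k_mul : ∀ a b, φ (Uq.k q) (a * b) = φ (Uq.k q) a * φ (Uq.k q) b)
    (kInv_mul : ∀ a b, φ (Uq.kInv q) (a * b) = φ (Uq.kInv q) a * φ (Uq.kInv q) b)
    (e_mul : ∀ a b, φ (Uq.e q) (a * b) = a * φ (Uq.e q) b + φ (Uq.e q) a * φ (Uq.k q) b)
    (f_mul : ∀ a b, φ (Uq.f q) (a * b) = φ (Uq.f q) a * b + φ (Uq.kInv q) a * φ (Uq.f q) b)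
    (k_one : φ (Uq.k q) 1 = 1) (kInv_one : φ (Uq.kInv q) 1 = 1)
    (e_one : φ (Uq.e q) 1 = 0) (f_one : φ (Uq.f q) 1 = 0) : HSymmetry (Uq q) A where
  toAlgHom := φ
  apply_mul h a b := by
    rw [comul_eq, ← tensorRep_apply_tmul]
    -- An identity of linear maps on `A ⊗ A`, so that it passes to products in `h`.
    suffices H : φ h ∘ₗ LinearMap.mul' ℂ A =
        LinearMap.mul' ℂ A ∘ₗ tensorRep φ (Uq.comulHom q h) from
      LinearMap.congr_fun H (a ⊗ₜ b)
    induction h using Uq.induction_on with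
    | hc c => ext; simp [Algebra.algebraMap_eq_smul_one]
    | hk =>
      refine TensorProduct.ext' fun a b => ?_
      simp [Uq.comulHom, tensorRep_tmul, k_mul]
    | hk' =>
      refine TensorProduct.ext' fun a b => ?_
      simp [Uq.comulHom, tensorRep_tmul, kInv_mul]
    | he =>
      refine TensorProduct.ext' fun a b => ?_
      simp [Uq.comulHom, tensorRep_tmul, e_mul]
    | hf =>
      refine TensorProduct.ext' fun a b => ?_
      simp [Uq.comulHom, tensorRep_tmul, f_mul]
    | hmul g h hg hh =>
      rw [map_mul, map_mul, map_mul, Module.End.mul_eq_comp, Module.End.mul_eq_comp,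
        LinearMap.comp_assoc, hh, ← LinearMap.comp_assoc, hg, LinearMap.comp_assoc]
    | hadd g h hg hh =>
      rw [map_add, map_add, map_add, LinearMap.add_comp, LinearMap.comp_add, hg, hh]
  apply_one h := by
    rw [counit_eq]
    induction h using Uq.induction_on with
    | hc c => simp [Algebra.algebraMap_eq_smul_one]
    | hk => simp [Uq.counitHom, k_one]
    | hk' => simp [Uq.counitHom, kInv_one]
    | he => simp [Uq.counitHom, e_one]
    | hf => simp [Uq.counitHom, f_one]
    | hmul g h hg hh => rw [map_mul, Module.End.mul_apply, hh, map_smul, hg, map_mul, smul_smul,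
        mul_comm]
    | hadd g h hg hh => rw [map_add, LinearMap.add_apply, hg, hh, map_add, add_smul]

section generators

variable (π : HSymmetry (Uq q) A) (a b : A)

theorem k_apply_mul :
    π.toAlgHom (Uq.k q) (a * b) = π.toAlgHom (Uq.k q) a * π.toAlgHom (Uq.k q) b := by
  rw [apply_mul_eq_tensorRep]; simp [Uq.comulHom, tensorRep_tmul]

theorem kInv_apply_mul :
    π.toAlgHom (Uq.kInv q) (a * b) = π.toAlgHom (Uq.kInv q) a * π.toAlgHom (Uq.kInv q) b := by
  rw [apply_mul_eq_tensorRep]; simp [Uq.comulHom, tensorRep_tmul]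

theorem k_apply_one : π.toAlgHom (Uq.k q) 1 = 1 := by
  rw [π.apply_one, counit_eq]; simp [Uq.counitHom]

theorem kInv_apply_one : π.toAlgHom (Uq.kInv q) 1 = 1 := by
  rw [π.apply_one, counit_eq]; simp [Uq.counitHom]

theorem kInv_apply_k : π.toAlgHom (Uq.kInv q) (π.toAlgHom (Uq.k q) a) = a := by
  rw [← Module.End.mul_apply, ← map_mul, Uq.kInv_mul_k, map_one, Module.End.one_apply]

theorem k_apply_kInv : π.toAlgHom (Uq.k q) (π.toAlgHom (Uq.kInv q) a) = a := by
  rw [← Module.End.mul_apply, ← map_mul, Uq.k_mul_kInv, map_one, Module.End.one_apply]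

/-- The algebra automorphism by which `k` acts. -/
def kEquiv : A ≃ₐ[ℂ] A :=
  AlgEquiv.ofAlgHom (AlgHom.ofLinearMap (π.toAlgHom (Uq.k q)) π.k_apply_one π.k_apply_mul)
    (AlgHom.ofLinearMap (π.toAlgHom (Uq.kInv q)) π.kInv_apply_one π.kInv_apply_mul)
    (AlgHom.ext π.k_apply_kInv) (AlgHom.ext π.kInv_apply_k)

theorem kEquiv_apply : π.kEquiv a = π.toAlgHom (Uq.k q) a := rfl

end generators

/-! ### Inner symmetries -/

/-- The scalar `q³ / (1 - q²)²`: the value of `M N` for which the twisted inner derivations of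
`M` and `N` satisfy the relation for `ef - fe`. -/
def innerScalar (q : ℂˣ) : ℂ := (q : ℂ) ^ 3 / (1 - (q : ℂ) ^ 2) ^ 2

theorem innerScalar_mul (h : (q : ℂ) ^ 2 ≠ 1) :
    innerScalar q * (1 - ((q : ℂ) ^ 2)⁻¹) = ((q : ℂ) - (q : ℂ)⁻¹)⁻¹ := by
  have hq : (q : ℂ) ≠ 0 := q.ne_zero
  have h1 : 1 - (q : ℂ) ^ 2 ≠ 0 := sub_ne_zero.2 h.symm
  have h2 : (q : ℂ) - (q : ℂ)⁻¹ ≠ 0 := by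
    intro h0
    apply h1
    field_simp at h0
    linear_combination -h0
  refine eq_inv_of_mul_eq_one_left ?_
  rw [innerScalar]
  field_simp
  ring

/-- The twisted inner derivation `a ↦ a M - M K(a)`. -/
def innerE (K : A ≃ₐ[ℂ] A) (M : A) : Module.End ℂ A :=
  LinearMap.mulRight ℂ M - LinearMap.mulLeft ℂ M ∘ₗ K.toLinearMap

theorem innerE_apply (K : A ≃ₐ[ℂ] A) (M a : A) : innerE K M a = a * M - M * K a := rfl

/-- The twisted inner derivation `a ↦ N a - K⁻¹(a) N`. -/
def innerF (K : A ≃ₐ[ℂ] A) (N : A) : Module.End ℂ A :=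
  LinearMap.mulLeft ℂ N - LinearMap.mulRight ℂ N ∘ₗ K.symm.toLinearMap

theorem innerF_apply (K : A ≃ₐ[ℂ] A) (N a : A) : innerF K N a = N * a - K.symm a * N := rfl

theorem innerE_mul (K : A ≃ₐ[ℂ] A) (M a b : A) :
    innerE K M (a * b) = a * innerE K M b + innerE K M a * K b := by
  simp only [innerE_apply, map_mul]
  noncomm_ring

theorem innerF_mul (K : A ≃ₐ[ℂ] A) (N a b : A) :
    innerF K N (a * b) = innerF K N a * b + K.symm a * innerF K N b := by
  simp only [innerF_apply, map_mul]
  noncomm_ring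

/-- The symmetry in which `k` acts by an automorphism `K`, and `e`, `f` act by the twisted inner
derivations of two eigenvectors of `K` that are inverse to each other up to `innerScalar q`. -/
def inner (K : A ≃ₐ[ℂ] A) (M N : A) (hq : (q : ℂ) ^ 2 ≠ 1) (hM : K M = ((q : ℂ) ^ 2) • M)
    (hN : K N = ((q : ℂ) ^ 2)⁻¹ • N) (hMN : M * N = innerScalar q • 1)
    (hNM : N * M = innerScalar q • 1) : HSymmetry (Uq q) A :=
  ofGenerators (Uq.lift K.toLinearMap K.symm.toLinearMap (innerE K M) (innerF K N)
      (by ext a; simp) (by ext a; simp)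
      (by
        ext a
        simp [innerE_apply, hM, smul_sub])
      (by
        ext a
        simp [innerF_apply, hN, smul_sub])
      (by
        have hq0 : (q : ℂ) ^ 2 ≠ 0 := by simp
        have hM' : K.symm M = ((q : ℂ) ^ 2)⁻¹ • M := by
          rw [AlgEquiv.symm_apply_eq, map_smul, hM, smul_smul, inv_mul_cancel₀ hq0, one_smul]
        have hs : ((q : ℂ) - (q : ℂ)⁻¹)⁻¹ =
            innerScalar q - innerScalar q * ((q : ℂ) ^ 2)⁻¹ := by
          linear_combination - innerScalar_mul hq
        ext a
        have h1 : K.symm a * N * M = innerScalar q • K.symm a := by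
          rw [mul_assoc, hNM, mul_smul_comm, mul_one]
        have h2 : M * (N * K a) = innerScalar q • K a := by
          rw [← mul_assoc, hMN, smul_mul_assoc, one_mul]
        have h3 : N * (M * K a) = innerScalar q • K a := by
          rw [← mul_assoc, hNM, smul_mul_assoc, one_mul]
        have h4 : K.symm a * M * N = innerScalar q • K.symm a := by
          rw [mul_assoc, hMN, mul_smul_comm, mul_one]
        simp only [LinearMap.sub_apply, Module.End.mul_apply, LinearMap.smul_apply, innerE_apply,
          innerF_apply, AlgEquiv.toLinearMap_apply, map_sub, map_mul, hN, hM',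
          smul_mul_assoc, mul_smul_comm, AlgEquiv.apply_symm_apply, AlgEquiv.symm_apply_apply,
          h1, h2, h3, h4, hs, ← mul_assoc N a M, ← mul_assoc M a N]
        module))
    (by intros; simp) (by intros; simp)
    (by
      intro a b
      simp only [Uq.lift_e, Uq.lift_k, AlgEquiv.toLinearMap_apply, innerE_mul])
    (by
      intro a b
      simp only [Uq.lift_f, Uq.lift_kInv, AlgEquiv.toLinearMap_apply, innerF_mul])
    (by simp) (by simp) (by simp [innerE_apply]) (by simp [innerF_apply])

section inner

variable (K : A ≃ₐ[ℂ] A) (M N : A) (hq : (q : ℂ) ^ 2 ≠ 1) (hM : K M = ((q : ℂ) ^ 2) • M)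
    (hN : K N = ((q : ℂ) ^ 2)⁻¹ • N) (hMN : M * N = innerScalar q • 1)
    (hNM : N * M = innerScalar q • 1)

theorem inner_k (a : A) : (inner K M N hq hM hN hMN hNM).toAlgHom (Uq.k q) a = K a := by
  simp [inner, ofGenerators]

theorem inner_kInv (a : A) :
    (inner K M N hq hM hN hMN hNM).toAlgHom (Uq.kInv q) a = K.symm a := by
  simp [inner, ofGenerators]

theorem inner_e (a : A) :
    (inner K M N hq hM hN hMN hNM).toAlgHom (Uq.e q) a = a * M - M * K a := by
  simp [inner, ofGenerators, innerE_apply]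

theorem inner_f (a : A) :
    (inner K M N hq hM hN hMN hNM).toAlgHom (Uq.f q) a = N * a - K.symm a * N := by
  simp [inner, ofGenerators, innerF_apply]

end inner

end HSymmetry

/-! ### Symmetries of inner type -/

namespace HSymmetry

variable {q : ℂˣ} {A : Type*} [Ring A] [Algebra ℂ A]

/-- A symmetry is of inner type if `k` acts diagonally on the units, fixes no units except the
scalars, and `e`, `f` act as twisted inner derivations implemented by a unit of weight `q²` and
a scalar multiple of its inverse. No generators of `A` enter, so that isomorphisms preserve the
property. -/
def IsInner (π : HSymmetry (Uq q) A) : Prop :=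
  ∃ (M : Aˣ) (N : A),
    (∀ a, π.toAlgHom (Uq.e q) a = a * M - M * π.toAlgHom (Uq.k q) a) ∧
    (∀ a, π.toAlgHom (Uq.f q) a = N * a - π.toAlgHom (Uq.kInv q) a * N) ∧
    (M : A) * N = innerScalar q • 1 ∧
    π.toAlgHom (Uq.k q) M = ((q : ℂ) ^ 2) • (M : A) ∧
    (∀ w : Aˣ, ∃ c : ℂ, π.toAlgHom (Uq.k q) w = c • (w : A)) ∧
    ∀ w : Aˣ, π.toAlgHom (Uq.k q) w = w → ∃ c : ℂ, (w : A) = algebraMap ℂ A c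

theorem IsInner.of_isIsomorphic {π₁ π₂ : HSymmetry (Uq q) A} (h : IsInner π₁)
    (h₁₂ : IsIsomorphic π₁ π₂) : IsInner π₂ := by
  obtain ⟨M, N, he, hf, hMN, hM, hd, hfix⟩ := h
  obtain ⟨Ψ, hΨ⟩ := h₁₂
  let pull (w : Aˣ) : Aˣ := Units.map (Ψ.symm : A →* A) w
  have hpull (w : Aˣ) : (pull w : A) = Ψ.symm w := rfl
  refine ⟨Units.map (Ψ : A →* A) M, Ψ N, fun a => ?_, fun a => ?_, ?_, ?_, fun w => ?_,
    fun w hw => ?_⟩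
  · rw [← hΨ, ← hΨ, he]; simp
  · rw [← hΨ, ← hΨ, hf]; simp
  · change Ψ M * Ψ N = _
    rw [← map_mul, hMN, map_smul, map_one]
  · change π₂.toAlgHom (Uq.k q) (Ψ M) = _ • Ψ M
    rw [← hΨ, AlgEquiv.symm_apply_apply, hM, map_smul]
  · obtain ⟨c, hc⟩ := hd (pull w)
    refine ⟨c, ?_⟩
    rw [← hΨ, ← hpull, hc, map_smul, hpull, AlgEquiv.apply_symm_apply]
  · obtain ⟨c, hc⟩ := hfix (pull w) (by
      apply Ψ.injective
      rw [hpull, hΨ, hw, AlgEquiv.apply_symm_apply])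
    refine ⟨c, ?_⟩
    rw [← Ψ.apply_symm_apply (w : A), ← hpull, hc, AlgEquiv.commutes]

end HSymmetry

open QLaurent HSymmetry

variable {q : ℂˣ}

/-! ### Symmetries of inner type are generic -/

namespace QLaurent

theorem map_monomial {α β : ℂ} (hα : α ≠ 0) (hβ : β ≠ 0) (φ : QLaurent q →ₐ[ℂ] QLaurent q)
    (hX : φ (X q) = α • (X q : QLaurent q)) (hY : φ (Y q) = β • (Y q : QLaurent q)) (i j : ℤ) :
    φ (monomial q i j) = (α ^ i * β ^ j) • monomial q i j := by
  have hw {c : ℂ} (hc : c ≠ 0) (w : (QLaurent q)ˣ) (h : φ w = c • (w : QLaurent q)) :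
      Units.map (φ : QLaurent q →* QLaurent q) w = unitScalar _ (Units.mk0 c hc) * w :=
    Units.ext (h.trans (Algebra.smul_def _ _))
  have h : Units.map (φ : QLaurent q →* QLaurent q) (X q ^ i * Y q ^ j) =
      unitScalar _ (Units.mk0 α hα ^ i * Units.mk0 β hβ ^ j) * (X q ^ i * Y q ^ j) := by
    rw [map_mul, map_zpow, map_zpow, hw hα _ hX, hw hβ _ hY, (commute_unitScalar _ _).mul_zpow,
      (commute_unitScalar _ _).mul_zpow, map_mul, map_zpow, map_zpow]
    simp only [mul_assoc]
    rw [← mul_assoc (X q ^ i), ← mul_assoc _ (X q ^ i), ← map_zpow _ (Units.mk0 β hβ),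
      (commute_unitScalar _ (X q ^ i)).eq]
  refine (congrArg Units.val h).trans ?_
  rw [Units.val_mul, coe_unitScalar, ← Algebra.smul_def]
  simp [monomial]

/-- The scalar by which `x^i y^j` fails to be inverse to `x^{-i} y^{-j}`. -/
theorem monomial_mul_monomial_neg (i j : ℤ) :
    monomial q i j * monomial q (-i) (-j) = ((q : ℂ) ^ (-(i * j))) • (1 : QLaurent q) := by
  rw [monomial_mul_monomial, add_neg_cancel, add_neg_cancel, monomial_zero, mul_neg, mul_comm]

/-- A monomial, as a unit. -/
def monomialUnit (q : ℂˣ) (i j : ℤ) : (QLaurent q)ˣ := X q ^ i * Y q ^ j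

theorem coe_monomialUnit (i j : ℤ) : (monomialUnit q i j : QLaurent q) = monomial q i j := rfl

/-- Independent weights: the units, being multiples of monomials, are eigenvectors, and only scalar
units are fixed. -/
theorem apply_units_of_independent {K : QLaurent q →ₐ[ℂ] QLaurent q} {α β : ℂ}
    (hα : α ≠ 0) (hβ : β ≠ 0)
    (hX : K (X q) = α • (X q : QLaurent q)) (hY : K (Y q) = β • (Y q : QLaurent q))
    (hαβ : ∀ m n : ℤ, (m, n) ≠ (0, 0) → α ^ m * β ^ n ≠ 1) :
    (∀ w : (QLaurent q)ˣ, ∃ c : ℂ, K w = c • (w : QLaurent q)) ∧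
    ∀ w : (QLaurent q)ˣ, K w = w → ∃ c : ℂ, (w : QLaurent q) = algebraMap ℂ _ c := by
  refine ⟨fun w => ?_, fun w hw => ?_⟩
  · obtain ⟨c, i, j, h⟩ := exists_eq_smul_monomial w
    exact ⟨α ^ i * β ^ j, by rw [h, map_smul, map_monomial hα hβ K hX hY, smul_comm]⟩
  · obtain ⟨c, i, j, h⟩ := exists_eq_smul_monomial w
    refine ⟨c, ?_⟩
    rw [h, map_smul, map_monomial hα hβ K hX hY, smul_right_inj c.ne_zero] at hw
    have hij : (i, j) = (0, 0) := by
      by_contra hne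
      exact hαβ i j hne (eq_of_monomial_eq_smul hw.symm).2
    obtain ⟨rfl, rfl⟩ := Prod.ext_iff.1 hij
    rw [h, monomial_zero, Algebra.algebraMap_eq_smul_one]

section inner

variable {K : QLaurent q ≃ₐ[ℂ] QLaurent q} {α β : ℂ}

theorem symm_apply_eq_inv_smul {A : Type*} [Ring A] [Algebra ℂ A] {K : A ≃ₐ[ℂ] A} {c : ℂ}
    (hc : c ≠ 0) {a : A} (h : K a = c • a) : K.symm a = c⁻¹ • a := by
  rw [AlgEquiv.symm_apply_eq, map_smul, h, smul_smul, inv_mul_cancel₀ hc, one_smul]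

theorem innerE_monomial_X (hX : K (X q) = α • (X q : QLaurent q)) (c : ℂ) (u v : ℤ) :
    innerE K (c • monomial q u v) (X q) =
      (c * (1 - α * (q : ℂ) ^ v)) • monomial q (u + 1) v := by
  rw [innerE_apply, hX, X_eq_monomial]
  simp only [smul_mul_assoc, mul_smul_comm, monomial_mul_monomial, zero_mul, mul_one, zpow_zero,
    one_smul, zero_add, add_zero, add_comm 1 u]
  module

theorem innerE_monomial_Y (hY : K (Y q) = β • (Y q : QLaurent q)) (c : ℂ) (u v : ℤ) :
    innerE K (c • monomial q u v) (Y q) =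
      (c * ((q : ℂ) ^ u - β)) • monomial q u (v + 1) := by
  rw [innerE_apply, hY, Y_eq_monomial]
  simp only [smul_mul_assoc, mul_smul_comm, monomial_mul_monomial, one_mul, mul_zero, zpow_zero,
    one_smul, zero_add, add_zero, add_comm 1 v]
  module

theorem innerF_monomial_X (hα : α ≠ 0) (hX : K (X q) = α • (X q : QLaurent q)) (d : ℂ)
    (u v : ℤ) :
    innerF K (d • monomial q (-u) (-v)) (X q) =
      (-((α⁻¹ - (q : ℂ) ^ (-v)) * d)) • monomial q (-u + 1) (-v) := by
  rw [innerF_apply, symm_apply_eq_inv_smul hα hX, X_eq_monomial]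
  simp only [smul_mul_assoc, mul_smul_comm, monomial_mul_monomial, zero_mul, mul_one, zpow_zero,
    one_smul, zero_add, add_zero, add_comm 1 (-u)]
  module

theorem innerF_monomial_Y (hβ : β ≠ 0) (hY : K (Y q) = β • (Y q : QLaurent q)) (d : ℂ)
    (u v : ℤ) :
    innerF K (d • monomial q (-u) (-v)) (Y q) =
      (-((β⁻¹ * (q : ℂ) ^ (-u) - 1) * d)) • monomial q (-u) (-v + 1) := by
  rw [innerF_apply, symm_apply_eq_inv_smul hβ hY, Y_eq_monomial]
  simp only [smul_mul_assoc, mul_smul_comm, monomial_mul_monomial, one_mul, mul_zero, zpow_zero,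
    one_smul, zero_add, add_zero, add_comm 1 (-v)]
  module

end inner

end QLaurent

theorem one_sub_sq_ne_zero (hq : ∀ n : ℤ, n ≠ 0 → q ^ n ≠ 1) : 1 - (q : ℂ) ^ 2 ≠ 0 := by
  intro h
  refine hq 2 two_ne_zero (Units.ext ?_)
  push_cast
  exact_mod_cast (sub_eq_zero.1 h).symm

/-- The exponents `u`, `v` and the parameter `a` are read off from the unit `M` that implements
`e`, which is a multiple of a monomial. -/
theorem mem_genericSymmetries_of_isInner (hq : ∀ n : ℤ, n ≠ 0 → q ^ n ≠ 1) {π : UqSymmetry q}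
    (h : IsInner π) : π ∈ genericSymmetries q := by
  obtain ⟨M, N, he, hf, hMN, hM, hd, hfix⟩ := h
  have hq0 : (q : ℂ) ≠ 0 := q.ne_zero
  have hq1 := one_sub_sq_ne_zero hq
  obtain ⟨α, hkX⟩ := hd (X q)
  obtain ⟨β, hkY⟩ := hd (Y q)
  have hne {c : ℂ} (w : (QLaurent q)ˣ)
      (hw : π.toAlgHom (Uq.k q) w = c • (w : QLaurent q)) : c ≠ 0 := by
    rintro rfl
    rw [zero_smul, ← kEquiv_apply, map_eq_zero_iff _ π.kEquiv.injective] at hw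
    exact w.ne_zero hw
  have hα := hne _ hkX
  have hβ := hne _ hkY
  have hmon := map_monomial hα hβ (π.kEquiv : QLaurent q →ₐ[ℂ] QLaurent q) hkX hkY
  obtain ⟨c, u, v, hMc⟩ := exists_eq_smul_monomial M
  have hc0 : (c : ℂ) ≠ 0 := c.ne_zero
  have hz := zpow_ne_zero (u * v) hq0
  have hN : N = (innerScalar q / c * (q : ℂ) ^ (u * v)) • monomial q (-u) (-v) := by
    refine M.isUnit.mul_left_cancel ?_
    rw [hMN, hMc, smul_mul_smul_comm, monomial_mul_monomial_neg, smul_smul, zpow_neg]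
    congr 1
    field_simp
  -- The value of `a` for which the coefficient of `M` is `a q^{uv+3} / (1 - q²)²`.
  set a : ℂ := c * (1 - (q : ℂ) ^ 2) ^ 2 / (q : ℂ) ^ (u * v + 3) with ha
  have ha0 : a ≠ 0 := div_ne_zero (mul_ne_zero hc0 (pow_ne_zero _ hq1)) (zpow_ne_zero _ hq0)
  have hz3 : (q : ℂ) ^ (u * v + 3) = (q : ℂ) ^ (u * v) * (q : ℂ) ^ 3 := by
    rw [zpow_add₀ hq0]; norm_cast
  have hca : (c : ℂ) = a * (q : ℂ) ^ (u * v + 3) / (1 - (q : ℂ) ^ 2) ^ 2 := by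
    rw [ha, hz3]; field_simp
  have hNa : innerScalar q / c * (q : ℂ) ^ (u * v) = a⁻¹ := by
    rw [ha, innerScalar, hz3]; field_simp
  rw [hNa] at hN
  have he' (b : QLaurent q) : π.toAlgHom (Uq.e q) b =
      innerE π.kEquiv ((c : ℂ) • monomial q u v) b := by
    rw [he, hMc]; rfl
  have hf' (b : QLaurent q) : π.toAlgHom (Uq.f q) b =
      innerF π.kEquiv (a⁻¹ • monomial q (-u) (-v)) b := by
    rw [hf, hN]; rfl
  refine ⟨α, β, a, u, v, hα, hβ, ha0, ?_, fun m n hmn h1 => ?_, hkX, hkY, ?_, ?_, ?_, ?_⟩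
  · have h := hmon u v
    change π.toAlgHom (Uq.k q) _ = _ at h
    rw [hMc, map_smul, h, smul_comm ((q : ℂ) ^ 2), smul_right_inj hc0] at hM
    exact smul_left_injective ℂ (monomialUnit q u v).ne_zero hM
  · have h := hmon m n
    rw [h1, one_smul] at h
    obtain ⟨d, hd'⟩ := hfix (monomialUnit q m n) h
    rw [coe_monomialUnit, Algebra.algebraMap_eq_smul_one, ← monomial_zero] at hd'
    exact hmn (eq_of_monomial_eq_smul hd').1
  · rw [he', innerE_monomial_X hkX, hca]
    congr 1; ring
  · rw [he', innerE_monomial_Y hkY, hca]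
    congr 1; ring
  · rw [hf', innerF_monomial_X hα hkX, div_eq_mul_inv]
  · rw [hf', innerF_monomial_Y hβ hkY, div_eq_mul_inv]

/-! ### An uncountable family -/

/-- The torus action `x ↦ s x`, `y ↦ t y`. -/
def torusHom (q s t : ℂˣ) : QLaurent q →ₐ[ℂ] QLaurent q :=
  QLaurent.lift (unitScalar _ s * X q) (unitScalar _ t * Y q) (by
    simp only [Units.val_mul, coe_unitScalar, ← Algebra.smul_def, smul_mul_assoc, mul_smul_comm,
      Y_mul_X]
    module)

theorem torusHom_X (s t : ℂˣ) : torusHom q s t (X q) = (s : ℂ) • (X q : QLaurent q) := by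
  rw [torusHom, lift_X, Units.val_mul, coe_unitScalar, Algebra.smul_def]

theorem torusHom_Y (s t : ℂˣ) : torusHom q s t (Y q) = (t : ℂ) • (Y q : QLaurent q) := by
  rw [torusHom, lift_Y, Units.val_mul, coe_unitScalar, Algebra.smul_def]

/-- The torus action as an automorphism. -/
def torusEquiv (q s t : ℂˣ) : QLaurent q ≃ₐ[ℂ] QLaurent q :=
  AlgEquiv.ofAlgHom (torusHom q s t) (torusHom q s⁻¹ t⁻¹)
    (QLaurent.algHom_ext (by simp [torusHom_X]) (by simp [torusHom_Y]))
    (QLaurent.algHom_ext (by simp [torusHom_X]) (by simp [torusHom_Y]))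

/-- For the weight `q²` of `x` and any independent weight `β` of `y`, there is a symmetry of inner
type in which `x` implements `e`. -/
theorem exists_isInner (hq : ∀ n : ℤ, n ≠ 0 → q ^ n ≠ 1) (β : ℂˣ)
    (hβ : ∀ m n : ℤ, (m, n) ≠ (0, 0) → ((q : ℂ) ^ 2) ^ m * (β : ℂ) ^ n ≠ 1) :
    ∃ π : UqSymmetry q, IsInner π ∧
      π.toAlgHom (Uq.k q) (X q) = ((q : ℂ) ^ 2) • (X q : QLaurent q) ∧
      π.toAlgHom (Uq.k q) (Y q) = (β : ℂ) • (Y q : QLaurent q) := by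
  have hq0 : (q : ℂ) ^ 2 ≠ 0 := pow_ne_zero _ q.ne_zero
  set K := torusEquiv q (q ^ 2) β
  have hX : K (X q) = ((q : ℂ) ^ 2) • (X q : QLaurent q) := by
    rw [← Units.val_pow_eq_pow_val]
    exact torusHom_X (q ^ 2) β
  have hY : K (Y q) = (β : ℂ) • (Y q : QLaurent q) := torusHom_Y _ _
  have hX' : K ((X q)⁻¹ : (QLaurent q)ˣ) =
      ((q : ℂ) ^ 2)⁻¹ • (((X q)⁻¹ : (QLaurent q)ˣ) : QLaurent q) := by
    simpa [monomial] using
      map_monomial hq0 β.ne_zero (K : QLaurent q →ₐ[ℂ] QLaurent q) hX hY (-1) 0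
  set N : QLaurent q := innerScalar q • (((X q)⁻¹ : (QLaurent q)ˣ) : QLaurent q)
  have hN : K N = ((q : ℂ) ^ 2)⁻¹ • N := by rw [map_smul, hX', smul_comm]
  have hMN : (X q : QLaurent q) * N = innerScalar q • 1 := by
    rw [mul_smul_comm, Units.mul_inv]
  have hNM : N * (X q : QLaurent q) = innerScalar q • 1 := by
    rw [smul_mul_assoc, Units.inv_mul]
  have hq2 : (q : ℂ) ^ 2 ≠ 1 := (sub_ne_zero.1 (one_sub_sq_ne_zero hq)).symm
  have hk := inner_k K (X q : QLaurent q) N hq2 hX hN hMN hNM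
  refine ⟨HSymmetry.inner K (X q) N hq2 hX hN hMN hNM, ⟨X q, N, fun a => ?_, fun a => ?_, hMN,
    by rw [hk, hX], ?_⟩, by rw [hk, hX], by rw [hk, hY]⟩
  · rw [inner_e, inner_k]
  · rw [inner_f, inner_kInv]
  · simp only [hk]
    exact apply_units_of_independent (K := (K : QLaurent q →ₐ[ℂ] QLaurent q)) hq0 β.ne_zero hX hY hβ

/-- The weights of `y` that are independent of the weight `q²`. -/
def independentWeights (q : ℂˣ) : Set ℂˣ :=
  {β | ∀ m n : ℤ, (m, n) ≠ (0, 0) → ((q : ℂ) ^ 2) ^ m * (β : ℂ) ^ n ≠ 1}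

theorem not_countable_independentWeights (hq : ∀ n : ℤ, n ≠ 0 → q ^ n ≠ 1) :
    ¬ (independentWeights q).Countable := by
  intro hB
  have hroot (c : ℂˣ) {n : ℤ} (hn : n ≠ 0) : {β : ℂˣ | β ^ n = c}.Finite := by
    have hnat (d : ℂˣ) : {β : ℂˣ | β ^ n.natAbs = d}.Finite := by
      refine Set.Finite.of_finite_image (f := Units.val) ?_ Units.val_injective.injOn
      refine (Polynomial.nthRoots n.natAbs (d : ℂ)).toFinset.finite_toSet.subset ?_
      rintro _ ⟨β, rfl, rfl⟩
      simp [Polynomial.mem_nthRoots (Int.natAbs_pos.2 hn)]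
    refine ((hnat c).union (hnat c⁻¹)).subset fun β hβ => ?_
    rcases Int.natAbs_eq n with h | h
    · left
      change β ^ n = c at hβ
      rwa [h, zpow_natCast] at hβ
    · right
      change β ^ n = c at hβ
      rw [h, zpow_neg, zpow_natCast] at hβ
      exact inv_eq_iff_eq_inv.1 hβ
  have hC : (independentWeights q)ᶜ ⊆
      ⋃ (m : ℤ) (n : ℤ) (_ : n ≠ 0), {β : ℂˣ | β ^ n = q ^ (-(2 * m))} := by
    intro β hβ
    simp only [independentWeights, Set.mem_compl_iff, Set.mem_ofPred_eq] at hβ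
    push Not at hβ
    obtain ⟨m, n, hmn, h⟩ := hβ
    have h' : q ^ (2 * m) * β ^ n = 1 := by
      refine Units.ext ?_
      rw [zpow_mul]
      push_cast
      exact_mod_cast h
    simp only [Set.mem_iUnion]
    refine ⟨m, n, ?_, ?_⟩
    · rintro rfl
      rw [zpow_zero, mul_one] at h'
      refine hq (2 * m) (fun h0 => hmn ?_) h'
      rw [show m = 0 by lia]
    · change β ^ n = _
      rw [zpow_neg]
      exact eq_inv_of_mul_eq_one_right h'
  have hCc : (independentWeights q)ᶜ.Countable := by
    refine Set.Countable.mono hC ?_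
    exact Set.countable_iUnion fun m => Set.countable_iUnion fun n =>
      Set.countable_iUnion fun hn => (hroot _ hn).countable
  have hU : (Set.univ : Set ℂˣ).Countable := by
    rw [← Set.union_compl_self (independentWeights q)]
    exact hB.union hCc
  refine not_countable_complex (((hU.image Units.val).insert 0).mono fun z _ => ?_)
  by_cases hz : z = 0
  · exact Or.inl hz
  · exact Or.inr ⟨Units.mk0 z hz, trivial, rfl⟩

theorem proposition3p6 (q : ℂˣ) (hq : ∀ n : ℤ, n ≠ 0 → q ^ n ≠ 1) :
    ¬ {C ∈ (HSymmetry.isoSetoid (Uq q) (QLaurent q)).classes |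
        C ⊆ genericSymmetries q}.Countable := by
  intro hS
  choose sym hinner hsymX hsymY using fun β : independentWeights q => exists_isInner hq β β.2
  set cls : independentWeights q → Set (UqSymmetry q) :=
    fun β => {π | IsIsomorphic π (sym β)}
  have hcls (β : independentWeights q) :
      cls β ∈ {C ∈ (HSymmetry.isoSetoid (Uq q) (QLaurent q)).classes |
        C ⊆ genericSymmetries q} :=
    ⟨(isoSetoid _ _).mem_classes (sym β), fun _ hπ =>
      mem_genericSymmetries_of_isInner hq ((hinner β).of_isIsomorphic ((isoSetoid _ _).symm hπ))⟩
  refine not_countable_independentWeights hq (Set.countable_coe_iff.1 (Set.countable_univ_iff.1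
    ((hS.biUnion (t := fun C _ => {β | cls β = C}) fun C _ => ?_).mono
      fun β _ => Set.mem_biUnion (hcls β) rfl)))
  -- All weights of `y` in one class lie in the group generated by `q²` and any one of them.
  rcases Set.eq_empty_or_nonempty {β | cls β = C} with h0 | ⟨β, rfl⟩
  · rw [h0]; exact Set.countable_empty
  refine ((Set.countable_range fun p : ℤ × ℤ =>
    (q ^ 2) ^ p.1 * (β : ℂˣ) ^ p.2).preimage_of_injOn Subtype.val_injective.injOn).mono ?_
  intro γ hγ
  obtain ⟨Ψ, hΨ⟩ : sym γ ∈ cls β := by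
    rw [← show cls γ = cls β from hγ]
    exact (isoSetoid _ _).refl (sym γ)
  obtain ⟨c, i, j, hw⟩ := exists_eq_smul_monomial
    (Units.map (Ψ : QLaurent q →* QLaurent q) (Y q))
  change Ψ (Y q) = _ at hw
  have h1 : (sym β).toAlgHom (Uq.k q) (Ψ (Y q)) = (γ : ℂˣ).val • Ψ (Y q) := by
    rw [← hΨ, AlgEquiv.symm_apply_apply, hsymY γ, map_smul]
  have h2 := map_monomial (pow_ne_zero 2 q.ne_zero) β.1.ne_zero
    ((sym β).kEquiv : QLaurent q →ₐ[ℂ] QLaurent q) (hsymX β) (hsymY β) i j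
  change (sym β).toAlgHom (Uq.k q) _ = _ at h2
  rw [hw, map_smul, h2, smul_comm (γ : ℂˣ).val, smul_right_inj c.ne_zero] at h1
  refine ⟨(i, j), Units.ext ?_⟩
  have h3 := smul_left_injective ℂ (monomialUnit q i j).ne_zero h1
  push_cast
  exact h3

end
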